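/- Let $\Sigma$ be a finite alphabet, $\Sigma^\star$ the set of finite strings over $\Sigma$, and $\mathcal{L}_2$ the Hilbert space of square-summable functions $\Sigma^\star\to\mathbb{R}$. A function $f\colon\Sigma^\star\to\mathbb{R}$ is rational if for some $n\ge 1$ there are $\alpha,\beta\in\mathbb{R}^n$ and matrices $A_a\in\mathbb{R}^{n\times n}$ ($a\in\Sigma$) such that $f(a_1\cdots a_t)=\alpha^\top A_{a_1}\cdots A_{a_t}\beta$ for every string $a_1\cdots a_t$. Its Hankel matrix is $H_f\in\mathbb{R}^{\Sigma^\star\times\Sigma^\star}$, $H_f(u,v)=f(uv)$. A matrix $M\in\mathbb{R}^{\Sigma^\star\times\Sigma^\star}$ is identified with the operator $(Mg)(x)=\sum_{y}M(x,y)g(y)$ on $\mathcal{L}_2$. If this operator is bounded and of finite rank, with singular values $\mathfrak{s}_1\ge\mathfrak{s}_2\ge\cdots$ (the square roots of the eigenvalues of $M^\top M$, with multiplicity, continued by zeros), then for $1\le p\le\infty$ the Schatten $p$-norm of $M$ is $\|M\|_{\mathrm{S},p}=\big(\sum_{i\ge1}\mathfrak{s}_i^p\big)^{1/p}$, read as $\sup_i\mathfrak{s}_i$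 when $p=\infty$. For rational $f$, the operator $H_f$ has finite rank whenever it is bounded; if it is not bounded on $\mathcal{L}_2$, put $\|H_f\|_{\mathrm{S},p}=\infty$. For $r>0$ let $\mathcal{H}_{p,r}$ be the class of rational functions $f$ with $\|H_f\|_{\mathrm{S},p}\le r$. Let $p,q\in[1,\infty]$ with $p^{-1}+q^{-1}=1$, let $r>0$ and $m\ge1$, and let $S=(x_1,\ldots,x_m)$ be a sample of $m$ strings in $\Sigma^\star$ with arbitrary decompositions $x_i=u_iv_i$, where $u_i,v_i\in\Sigma^\star$. Let $\sigma_1,\ldots,\sigma_m$ be independent and uniform on $\{+1,-1\}$, and let $e_w\in\mathbb{R}^{\Sigma^\star}$ be the indicator vector of the string $w$. Then for all values of the signs the supremum on the left and the norm on the right below are finite, and the empirical Rademacher complexity of $\mathcal{H}_{p,r}$ on $S$ satisfies $$\widehat{\mathfrak{R}}_S(\mathcal{H}_{p,r}):=\mathbb{E}\left[\sup_{f\in\mathcal{H}_{p,r}}\frac1m\sum_{i=1}^m\sigma_if(x_i)\right]\le\frac{r}{m}\,\mathbb{E}\left[\Big\|\sum_{i=1}^m\sigma_i e_{u_i}e_{v_i}^\top\Big\|_{\mathrm{S},q}\right].$$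 -/

import Mathlib

open scoped ENNReal

namespace HankelRademacher

noncomputable section

/-- A weighted finite automaton with `n` states over the alphabet `A`, with real weights. -/
structure WFA (A : Type*) (n : ℕ) where
  /-- initial weights -/
  init : Fin n → ℝ
  /-- final weights -/
  final : Fin n → ℝ
  /-- transition matrices -/
  trans : A → Matrix (Fin n) (Fin n) ℝ

/-- The function computed by a weighted automaton:
the word `a₁ ⋯ aₜ` is sent to `initᵀ * trans a₁ * ⋯ * trans aₜ * final`. -/
def WFA.eval {A : Type*} {n : ℕ} (W : WFA A n) (x : List A) : ℝ :=
  W.init ⬝ᵥ ((x.map W.trans).prod.mulVec W.final)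

/-- A function on words is rational if some weighted automaton with `n ≥ 1` states computes it. -/
def IsRational {A : Type*} (f : List A → ℝ) : Prop :=
  ∃ n : ℕ, 1 ≤ n ∧ ∃ W : WFA A n, f = W.eval

/-- The Hankel matrix of `f`: its `(u, v)` entry is `f (u v)`. -/
def hankelMatrix {A : Type*} (f : List A → ℝ) : Matrix (List A) (List A) ℝ :=
  Matrix.of fun u v => f (u ++ v)

/-- The Hilbert space of square summable real functions on words. -/
abbrev WordL2 (A : Type*) : Type _ := lp (fun _ : List A => ℝ) 2

/-- The bounded operator `T` is given by the infinite matrix `M`: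
`(T g)(x) = ∑ y, M x y * g y` for every square summable `g` and every word `x`. -/
def Represents {A : Type*} (M : Matrix (List A) (List A) ℝ)
    (T : WordL2 A →L[ℝ] WordL2 A) : Prop :=
  ∀ (g : WordL2 A) (x : List A), HasSum (fun y => M x y * g y) (T g x)

/-- A matrix is represented by at most one bounded operator. -/
theorem Represents.unique {A : Type*} {M : Matrix (List A) (List A) ℝ}
    {T T' : WordL2 A →L[ℝ] WordL2 A} (h : Represents M T) (h' : Represents M T') : T = T' := by
  ext g x
  exact (h g x).unique (h' g x)

/-- The singular values of a compact operator `T` between Hilbert spaces: the square roots of the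
eigenvalues of `T† T`, repeated according to multiplicity, in decreasing order, indexed from `0`,
and continued by `0`. Concretely, the value with index `i` is the largest `s ≥ 0` such that `T† T`
has `i + 1` orthonormal eigenvectors whose eigenvalues `(t j) ^ 2` satisfy `t j ≥ s`
(and it is `sSup ∅ = 0` if there is no such `s`). -/
def singularValue {E F : Type*} [NormedAddCommGroup E] [InnerProductSpace ℝ E] [CompleteSpace E]
    [NormedAddCommGroup F] [InnerProductSpace ℝ F] [CompleteSpace F]
    (T : E →L[ℝ] F) (i : ℕ) : ℝ :=
  sSup {s : ℝ | 0 ≤ s ∧ ∃ (v : Fin (i + 1) → E) (t : Fin (i + 1) → ℝ), Orthonormal ℝ v ∧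
    ∀ j, s ≤ t j ∧ ContinuousLinearMap.adjoint T (T (v j)) = (t j) ^ 2 • v j}

/-- The Schatten `p`-norm of a compact operator, `1 ≤ p ≤ ∞`: the `ℓᵖ` norm of its sequence of
singular values, with value `∞` if that norm is infinite. -/
def schattenNorm {E F : Type*} [NormedAddCommGroup E] [InnerProductSpace ℝ E] [CompleteSpace E]
    [NormedAddCommGroup F] [InnerProductSpace ℝ F] [CompleteSpace F]
    (p : ℝ≥0∞) (T : E →L[ℝ] F) : ℝ≥0∞ :=
  if p = ∞ then ⨆ i : ℕ, ENNReal.ofReal (singularValue T i)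
  else (∑' i : ℕ, ENNReal.ofReal (singularValue T i) ^ p.toReal) ^ (1 / p.toReal)

/-- The Schatten `p`-norm of an infinite matrix: that of the (unique) bounded operator on square
summable functions which the matrix represents, and `∞` if there is no such operator. -/
def matrixSchattenNorm {A : Type*} (p : ℝ≥0∞) (M : Matrix (List A) (List A) ℝ) : ℝ≥0∞ :=
  ⨅ (T : WordL2 A →L[ℝ] WordL2 A) (_ : Represents M T), schattenNorm p T

/-- The class of rational functions whose Hankel matrix has Schatten `p`-norm at most `r`. -/
def hankelSchattenBall (A : Type*) (p : ℝ≥0∞) (r : ℝ) : Set (List A → ℝ) :=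
  {f | IsRational f ∧ matrixSchattenNorm p (hankelMatrix f) ≤ ENNReal.ofReal r}

/-- Expectation over `m` independent uniform random signs. -/
def signExpectation {m : ℕ} (Y : (Fin m → ℤˣ) → ℝ) : ℝ :=
  (∑ σ : Fin m → ℤˣ, Y σ) / 2 ^ m

/-- The empirical correlation `(1 / m) ∑ i, σ i * f (x i)` of `f` with the signs `σ`. -/
def signCorrelation {X : Type*} {m : ℕ} (x : Fin m → X) (σ : Fin m → ℤˣ) (f : X → ℝ) : ℝ :=
  1 / (m : ℝ) * ∑ i, ((σ i : ℤ) : ℝ) * f (x i)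

/-- The empirical Rademacher complexity of the class `C` on the sample `x`. -/
def empiricalRademacher {X : Type*} {m : ℕ} (x : Fin m → X) (C : Set (X → ℝ)) : ℝ :=
  signExpectation fun σ : Fin m → ℤˣ => ⨆ f : C, signCorrelation x σ f

/-- The random matrix `∑ i, σ i * e_{u i} * (e_{v i})ᵀ`, where `e_w` is the indicator of `w`. -/
def signMatrix {A : Type*} [DecidableEq A] {m : ℕ} (u v : Fin m → List A) (σ : Fin m → ℤˣ) :
    Matrix (List A) (List A) ℝ :=
  ∑ i, ((σ i : ℤ) : ℝ) • Matrix.vecMulVec (Pi.single (u i) 1) (Pi.single (v i) 1)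

end

end HankelRademacher

open HankelRademacher

/-! The bound holds for each choice of signs separately; averaging comes last. If `T` is the
operator of `H_f` and `M = ∑ σ_i e_{u_i} e_{v_i}ᵀ`, then `f (x_i) = ⟪e_{u_i}, T e_{v_i}⟫`, so `∑ σ_i
f (x_i)` is the trace pairing of `T` and `M`, and Hölder's inequality for Schatten norms bounds it
by `r` times the `q`-norm of `M`.

That inequality (`sum_inner_le_schattenNorm_mul`) comes from inserting singular value decompositions
of both operators. The pairing becomes `∑ s_i t_j ⟪v'_j, v_i⟫ ⟪w'_j, w_i⟫`, whose coefficients are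
doubly substochastic in absolute value, so a weighted scalar Hölder inequality finishes. The
decomposition of `T` exists because a bounded Hankel operator of a rational function has finite
rank. -/

namespace HankelRademacher

open scoped InnerProductSpace

/-! ### Singular values and the decomposition of finite rank operators -/

section SingularValues

variable {E F : Type*} [NormedAddCommGroup E] [InnerProductSpace ℝ E] [CompleteSpace E]
  [NormedAddCommGroup F] [InnerProductSpace ℝ F] [CompleteSpace F]

theorem norm_apply_sq_of_adjoint_eigenvector {T : E →L[ℝ] F} {v : E} {c : ℝ}
    (hv : ‖v‖ = 1) (h : ContinuousLinearMap.adjoint T (T v) = c • v) : ‖T v‖ ^ 2 = c := by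
  rw [← real_inner_self_eq_norm_sq, ← ContinuousLinearMap.adjoint_inner_right, h,
    inner_smul_right, real_inner_self_eq_norm_sq, hv]
  ring

/-- One eigenvector suffices, since `t 0 = ± ‖T (v 0)‖`. This bounds the set defining a singular
value, so that its real supremum is meaningful. -/
theorem le_norm_of_adjoint_eigenvectors {T : E →L[ℝ] F} {i : ℕ} {s : ℝ} {v : Fin (i + 1) → E}
    {t : Fin (i + 1) → ℝ} (hv : Orthonormal ℝ v)
    (h : ∀ j, s ≤ t j ∧ ContinuousLinearMap.adjoint T (T (v j)) = (t j) ^ 2 • v j) :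
    s ≤ ‖T‖ := by
  have h1 := norm_apply_sq_of_adjoint_eigenvector (hv.1 0) (h 0).2
  have h2 : ‖T (v 0)‖ ≤ ‖T‖ := by simpa [hv.1 0] using T.le_opNorm (v 0)
  exact (h 0).1.trans ((le_abs_self _).trans
    (((sq_eq_sq_iff_abs_eq_abs _ _).1 h1.symm).trans_le (by rwa [abs_norm])))

theorem le_singularValue {T : E →L[ℝ] F} {i : ℕ} {s : ℝ} (hs : 0 ≤ s) {v : Fin (i + 1) → E}
    {t : Fin (i + 1) → ℝ} (hv : Orthonormal ℝ v)
    (h : ∀ j, s ≤ t j ∧ ContinuousLinearMap.adjoint T (T (v j)) = (t j) ^ 2 • v j) :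
    s ≤ singularValue T i :=
  le_csSup ⟨‖T‖, fun _ ⟨_, _, _, hv', h'⟩ => le_norm_of_adjoint_eigenvectors hv' h'⟩
    ⟨hs, v, t, hv, h⟩

theorem singularValue_le_norm (T : E →L[ℝ] F) (i : ℕ) : singularValue T i ≤ ‖T‖ :=
  Real.sSup_le (fun _ ⟨_, _, _, hv, h⟩ => le_norm_of_adjoint_eigenvectors hv h) (norm_nonneg _)

/-- A positive candidate `s` would give `i + 1` vectors `T (v j)` in the range; `T†` sends them to
nonzero multiples of the orthonormal `v j`, so they would be independent. -/
theorem singularValue_nonpos_of_finrank_le (T : E →L[ℝ] F)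
    [FiniteDimensional ℝ (LinearMap.range (T : E →ₗ[ℝ] F))] {i : ℕ}
    (hi : Module.finrank ℝ (LinearMap.range (T : E →ₗ[ℝ] F)) ≤ i) : singularValue T i ≤ 0 := by
  refine Real.sSup_nonpos ?_
  rintro s ⟨-, v, t, hv, h⟩
  by_contra! hs
  have hli : LinearIndependent ℝ fun j =>
      (⟨T (v j), v j, rfl⟩ : LinearMap.range (T : E →ₗ[ℝ] F)) := by
    refine LinearIndependent.of_comp
      ((ContinuousLinearMap.adjoint T : F →ₗ[ℝ] E) ∘ₗ Submodule.subtype _) ?_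
    have h0 : ∀ j, t j ^ 2 ≠ 0 := fun j => pow_ne_zero _ (hs.trans_le (h j).1).ne'
    convert! hv.linearIndependent.units_smul fun j => Units.mk0 _ (h0 j) using 1
    ext j
    simpa using (h j).2
  have := hli.fintype_card_le_finrank
  simp at this
  omega

theorem schattenNorm_ne_top (T : E →L[ℝ] F)
    [FiniteDimensional ℝ (LinearMap.range (T : E →ₗ[ℝ] F))] {p : ℝ≥0∞} (hp : 1 ≤ p) :
    schattenNorm p T ≠ ∞ := by
  unfold schattenNorm
  split_ifs with h
  · exact ne_top_of_le_ne_top ENNReal.ofReal_ne_top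
      (iSup_le fun i => ENNReal.ofReal_le_ofReal (singularValue_le_norm T i))
  · have hp0 : 0 < p.toReal := ENNReal.toReal_pos (zero_lt_one.trans_le hp).ne' h
    refine ENNReal.rpow_ne_top_of_nonneg (by positivity) ?_
    rw [tsum_eq_sum (s := Finset.range
      (Module.finrank ℝ (LinearMap.range (T : E →ₗ[ℝ] F))))]
    · exact ENNReal.sum_ne_top.2 fun i _ =>
        ENNReal.rpow_ne_top_of_nonneg hp0.le ENNReal.ofReal_ne_top
    · intro i hi
      rw [ENNReal.ofReal_of_nonpos
        (singularValue_nonpos_of_finrank_le T (by simpa using hi)), ENNReal.zero_rpow_of_pos hp0]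

/-- Singular value decomposition of a bounded operator of finite rank. -/
theorem exists_singularValueDecomposition (T : E →L[ℝ] F)
    [FiniteDimensional ℝ (LinearMap.range (T : E →ₗ[ℝ] F))] :
    ∃ (n : ℕ) (s : Fin n → ℝ) (v : Fin n → E) (w : Fin n → F), Orthonormal ℝ v ∧
      Orthonormal ℝ w ∧ (∀ i, 0 ≤ s i) ∧ (∀ i : Fin n, s i ≤ singularValue T i) ∧
      ∀ x, T x = ∑ i, (s i * ⟪v i, x⟫_ℝ) • w i := by
  set S : E →ₗ[ℝ] E := (ContinuousLinearMap.adjoint T : F →ₗ[ℝ] E) ∘ₗ (T : E →ₗ[ℝ] F) with hS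
  have hSa : ∀ x y, ⟪x, S y⟫_ℝ = ⟪T x, T y⟫_ℝ := fun x y =>
    ContinuousLinearMap.adjoint_inner_right T x (T y)
  have hSsymm : S.IsSymmetric := fun x y => by
    rw [real_inner_comm, hSa, hSa, real_inner_comm]
  -- The range of `S = T† T` is finite dimensional and `S`-invariant, so the finite-dimensional
  -- spectral theorem applies there and no compactness theory is needed.
  set V : Submodule ℝ E := LinearMap.range S with hV
  have : FiniteDimensional ℝ V := by
    rw [hV, hS, LinearMap.range_comp]
    infer_instance
  have hmaps : ∀ x ∈ V, S x ∈ V := fun x _ => ⟨x, rfl⟩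
  have hsymm := hSsymm.restrict_invariant hmaps
  set n := Module.finrank ℝ V with hn
  set b := hsymm.eigenvectorBasis hn.symm with hb
  set l := hsymm.eigenvalues hn.symm with hl
  set v : Fin n → E := fun i => (b i : E) with hv
  have hvo : Orthonormal ℝ v := b.orthonormal.comp_linearIsometry V.subtypeₗᵢ
  have hSv : ∀ i, S (v i) = l i • v i := fun i => by
    exact congrArg Subtype.val (hsymm.apply_eigenvectorBasis hn.symm i)
  have hTv : ∀ i j, ⟪T (v i), T (v j)⟫_ℝ = l j * ⟪v i, v j⟫_ℝ := fun i j => by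
    rw [← hSa, hSv, inner_smul_right]
  -- Zero is not an eigenvalue on `V`: writing `v i = S y`, the equality `T (v i) = 0` would force
  -- `⟪v i, v i⟫ = ⟪T (v i), T y⟫ = 0`.
  have hlpos : ∀ i, 0 < l i := fun i => by
    have h1 : ‖T (v i)‖ ^ 2 = l i := norm_apply_sq_of_adjoint_eigenvector (hvo.1 i) (hSv i)
    have h2 : T (v i) ≠ 0 := fun h0 => by
      obtain ⟨y, hy⟩ := (b i).2
      have : ⟪v i, v i⟫_ℝ = 0 := by
        conv_lhs => rw [hv]; simp only [← hy]
        rw [hSa]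
        simp only [hy]
        change ⟪T (v i), T y⟫_ℝ = 0
        rw [h0, inner_zero_left]
      rw [real_inner_self_eq_norm_sq, hvo.1] at this
      norm_num at this
    rw [← h1]
    positivity
  have hs : ∀ i, 0 < √(l i) := fun i => Real.sqrt_pos.2 (hlpos i)
  refine ⟨n, fun i => √(l i), v, fun i => (√(l i))⁻¹ • T (v i), hvo, ?_,
    fun i => Real.sqrt_nonneg _, ?_, ?_⟩
  · rw [orthonormal_iff_ite]
    intro i j
    rw [inner_smul_left, inner_smul_right, hTv, orthonormal_iff_ite.1 hvo]
    split_ifs with h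
    · subst h
      have := (hs i).ne'
      simp only [conj_trivial, mul_one]
      nth_rewrite 3 [← Real.mul_self_sqrt (hlpos i).le]
      field_simp
    · simp
  · intro i
    -- The first `i + 1` eigenvectors witness the bound, because the eigenvalues are listed in
    -- decreasing order.
    have hin : (i : ℕ) + 1 ≤ n := i.2
    refine le_singularValue (Real.sqrt_nonneg _)
      (v := fun j => v (Fin.castLE hin j)) (t := fun j => √(l (Fin.castLE hin j)))
      (hvo.comp _ (Fin.castLE_injective hin)) fun j => ⟨?_, ?_⟩
    · refine Real.sqrt_le_sqrt (hsymm.eigenvalues_antitone hn.symm ?_)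
      exact Fin.le_def.2 (Nat.lt_succ_iff.1 j.2)
    · rw [Real.sq_sqrt (hlpos _).le]
      exact hSv _
  · intro x
    -- For `z` orthogonal to the range of `S`, `‖T z‖² = ⟪z, S z⟫ = 0`.
    have hker : T (x - V.starProjection x) = 0 := by
      have h1 : x - V.starProjection x ∈ Vᗮ := V.sub_starProjection_mem_orthogonal x
      have h2 := hSa (x - V.starProjection x) (x - V.starProjection x)
      rw [Submodule.inner_left_of_mem_orthogonal (K := V) ⟨_, rfl⟩ h1] at h2
      exact inner_self_eq_zero.1 h2.symm
    rw [map_sub, sub_eq_zero] at hker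
    have hproj : V.starProjection x = ∑ i, ⟪v i, x⟫_ℝ • v i := by
      rw [Submodule.starProjection_apply, ← b.sum_repr' (V.orthogonalProjectionOnto x)]
      simp [hv]
    rw [hker, hproj, map_sum]
    refine Finset.sum_congr rfl fun i _ => ?_
    rw [map_smul, smul_smul]
    congr 1
    field_simp [(hs i).ne']

/-- Hölder needs only this direction, so lower bounds for the singular values suffice. -/
theorem sum_rpow_le_schattenNorm {T : E →L[ℝ] F} {p : ℝ≥0∞} (hp' : p ≠ ∞) {n : ℕ}
    {s : Fin n → ℝ} (hs : ∀ i : Fin n, s i ≤ singularValue T i) :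
    (∑ i, ENNReal.ofReal (s i) ^ p.toReal) ^ (1 / p.toReal) ≤ schattenNorm p T := by
  rw [schattenNorm, if_neg hp']
  refine ENNReal.rpow_le_rpow ?_ (by positivity)
  calc ∑ i, ENNReal.ofReal (s i) ^ p.toReal
      ≤ ∑ i : Fin n, ENNReal.ofReal (singularValue T i) ^ p.toReal := by
        gcongr with i
        exact hs i
    _ = ∑ i ∈ Finset.range n, ENNReal.ofReal (singularValue T i) ^ p.toReal :=
        Fin.sum_univ_eq_sum_range (fun i => ENNReal.ofReal (singularValue T i) ^ p.toReal) n
    _ ≤ _ := ENNReal.sum_le_tsum _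

theorem ofReal_le_schattenNorm_top {T : E →L[ℝ] F} {n : ℕ}
    {s : Fin n → ℝ} (hs : ∀ i : Fin n, s i ≤ singularValue T i) (i : Fin n) :
    ENNReal.ofReal (s i) ≤ schattenNorm ∞ T := by
  rw [schattenNorm, if_pos rfl]
  exact (ENNReal.ofReal_le_ofReal (hs i)).trans
    (le_iSup (fun i => ENNReal.ofReal (singularValue T i)) (i : ℕ))

end SingularValues

/-! ### Scalar Hölder inequalities with substochastic weights -/

section Holder

variable {ι κ : Type*} [Fintype ι] [Fintype κ]

/-- Hölder's inequality with doubly substochastic weights. -/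
theorem sum_mul_le_of_substochastic {p q : ℝ} (hpq : p.HolderConjugate q)
    {a : ι → κ → ℝ≥0∞} (hrow : ∀ i, ∑ j, a i j ≤ 1) (hcol : ∀ j, ∑ i, a i j ≤ 1)
    (s : ι → ℝ≥0∞) (t : κ → ℝ≥0∞) :
    ∑ i, ∑ j, s i * t j * a i j ≤ (∑ i, s i ^ p) ^ (1 / p) * (∑ j, t j ^ q) ^ (1 / q) := by
  have hp := hpq.pos
  have hq := hpq.symm.pos
  have hsum := hpq.inv_add_inv_eq_one
  -- Each weight is split between the two factors before applying Hölder on `ι × κ`; row sums then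
  -- control the `s` factor and column sums the `t` factor.
  have ha : ∀ i j, a i j ^ (1 / p) * a i j ^ (1 / q) = a i j := fun i j => by
    rw [← ENNReal.rpow_add_of_nonneg _ _ (by positivity) (by positivity), one_div, one_div, hsum,
      ENNReal.rpow_one]
  calc ∑ i, ∑ j, s i * t j * a i j
      = ∑ x : ι × κ, (s x.1 * a x.1 x.2 ^ (1 / p)) * (t x.2 * a x.1 x.2 ^ (1 / q)) := by
        rw [Fintype.sum_prod_type]
        refine Finset.sum_congr rfl fun i _ => Finset.sum_congr rfl fun j _ => ?_
        rw [mul_mul_mul_comm, ha]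
    _ ≤ (∑ x : ι × κ, (s x.1 * a x.1 x.2 ^ (1 / p)) ^ p) ^ (1 / p) *
          (∑ x : ι × κ, (t x.2 * a x.1 x.2 ^ (1 / q)) ^ q) ^ (1 / q) :=
        ENNReal.inner_le_Lp_mul_Lq _ _ _ hpq
    _ ≤ _ := by
        gcongr
        · rw [Fintype.sum_prod_type]
          refine Finset.sum_le_sum fun i _ => ?_
          simp only [ENNReal.mul_rpow_of_nonneg _ _ hp.le, ← ENNReal.rpow_mul,
            one_div_mul_cancel hp.ne', ENNReal.rpow_one]
          rw [← Finset.mul_sum]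
          exact mul_le_of_le_one_right' (hrow i)
        · rw [Fintype.sum_prod_type_right]
          refine Finset.sum_le_sum fun j _ => ?_
          simp only [ENNReal.mul_rpow_of_nonneg _ _ hq.le, ← ENNReal.rpow_mul,
            one_div_mul_cancel hq.ne', ENNReal.rpow_one]
          rw [← Finset.mul_sum]
          exact mul_le_of_le_one_right' (hcol j)

/-- The endpoint case of exponents `1` and `∞`, where only the row sums matter. -/
theorem sum_mul_le_of_substochastic_one_top {a : ι → κ → ℝ≥0∞} (hrow : ∀ i, ∑ j, a i j ≤ 1)
    (s : ι → ℝ≥0∞) {t : κ → ℝ≥0∞} {C : ℝ≥0∞} (ht : ∀ j, t j ≤ C) :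
    ∑ i, ∑ j, s i * t j * a i j ≤ (∑ i, s i) * C := by
  rw [Finset.sum_mul]
  refine Finset.sum_le_sum fun i _ => ?_
  calc ∑ j, s i * t j * a i j ≤ ∑ j, s i * C * a i j := by gcongr with j; exact ht j
    _ = s i * C * ∑ j, a i j := (Finset.mul_sum _ _ _).symm
    _ ≤ s i * C := mul_le_of_le_one_right' (hrow i)

end Holder

/-! ### Substochasticity of overlaps of orthonormal systems -/

section Duality

variable {E F : Type*} [NormedAddCommGroup E] [InnerProductSpace ℝ E]
  [NormedAddCommGroup F] [InnerProductSpace ℝ F]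

/-- `|ab| ≤ (a² + b²) / 2` followed by Bessel's inequality for each system. -/
theorem sum_abs_inner_mul_inner_le_one {κ : Type*} [Fintype κ] {v : κ → E} {w : κ → F}
    (hv : Orthonormal ℝ v) (hw : Orthonormal ℝ w) {x : E} {y : F} (hx : ‖x‖ = 1) (hy : ‖y‖ = 1) :
    ∑ j, ENNReal.ofReal |⟪v j, x⟫_ℝ * ⟪w j, y⟫_ℝ| ≤ 1 := by
  rw [← ENNReal.ofReal_sum_of_nonneg fun _ _ => abs_nonneg _, ENNReal.ofReal_le_one]
  have h1 : ∑ j, ⟪v j, x⟫_ℝ ^ 2 ≤ 1 := by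
    simpa [hx] using hv.sum_inner_products_le x (s := Finset.univ)
  have h2 : ∑ j, ⟪w j, y⟫_ℝ ^ 2 ≤ 1 := by
    simpa [hy] using hw.sum_inner_products_le y (s := Finset.univ)
  calc ∑ j, |⟪v j, x⟫_ℝ * ⟪w j, y⟫_ℝ|
      ≤ ∑ j, (⟪v j, x⟫_ℝ ^ 2 + ⟪w j, y⟫_ℝ ^ 2) / 2 := by
        refine Finset.sum_le_sum fun j _ => ?_
        rw [abs_mul, ← sq_abs ⟪v j, x⟫_ℝ, ← sq_abs ⟪w j, y⟫_ℝ]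
        linarith [two_mul_le_add_sq |⟪v j, x⟫_ℝ| |⟪w j, y⟫_ℝ|]
    _ ≤ 1 := by
        rw [← Finset.sum_div, Finset.sum_add_distrib]
        linarith

end Duality

/-! ### Hölder's inequality for Schatten norms -/

section TraceDuality

variable {E F : Type*} [NormedAddCommGroup E] [InnerProductSpace ℝ E] [CompleteSpace E]
  [NormedAddCommGroup F] [InnerProductSpace ℝ F] [CompleteSpace F]

/-- Hölder's inequality for Schatten norms: the trace pairing of a finite rank operator `T` with
`M = ∑ i, c i • y i ⊗ x i`. -/
theorem sum_inner_le_schattenNorm_mul (T M : E →L[ℝ] F)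
    [FiniteDimensional ℝ (LinearMap.range (T : E →ₗ[ℝ] F))]
    [FiniteDimensional ℝ (LinearMap.range (M : E →ₗ[ℝ] F))]
    {p q : ℝ≥0∞} (hp : 1 ≤ p) (hq : 1 ≤ q) (hpq : p⁻¹ + q⁻¹ = 1)
    {ι : Type*} [Fintype ι] {c : ι → ℝ} {x : ι → E} {y : ι → F}
    (hM : ∀ z, M z = ∑ i, (c i * ⟪x i, z⟫_ℝ) • y i) :
    ENNReal.ofReal (∑ i, c i * ⟪y i, T (x i)⟫_ℝ) ≤ schattenNorm p T * schattenNorm q M := by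
  obtain ⟨n, s, v, w, hv, hw, hs0, hs, hT⟩ := exists_singularValueDecomposition T
  obtain ⟨k, t, v', w', hv', hw', ht0, ht, hM'⟩ := exists_singularValueDecomposition M
  set a : Fin n → Fin k → ℝ≥0∞ :=
    fun i j => ENNReal.ofReal |⟪v' j, v i⟫_ℝ * ⟪w' j, w i⟫_ℝ| with ha
  have hrow : ∀ i, ∑ j, a i j ≤ 1 := fun i =>
    sum_abs_inner_mul_inner_le_one hv' hw' (hv.1 i) (hw.1 i)
  have hcol : ∀ j, ∑ i, a i j ≤ 1 := fun j => by
    simpa only [ha, real_inner_comm] using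
      sum_abs_inner_mul_inner_le_one hv hw (hv'.1 j) (hw'.1 j)
  -- Expanding `T` turns the pairing into `∑ s_l ⟪M (v l), w l⟫`, which no longer depends on the
  -- given expansion of `M`; its singular value decomposition can then replace that expansion.
  have key : ∑ i, c i * ⟪y i, T (x i)⟫_ℝ =
      ∑ i, ∑ j, s i * t j * (⟪v' j, v i⟫_ℝ * ⟪w' j, w i⟫_ℝ) := by
    calc ∑ i, c i * ⟪y i, T (x i)⟫_ℝ
        = ∑ i, ∑ l, s l * (c i * ⟪x i, v l⟫_ℝ * ⟪y i, w l⟫_ℝ) := by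
          refine Finset.sum_congr rfl fun i _ => ?_
          rw [hT, inner_sum, Finset.mul_sum]
          refine Finset.sum_congr rfl fun l _ => ?_
          rw [inner_smul_right, real_inner_comm (x i)]
          ring
      _ = ∑ l, s l * ⟪M (v l), w l⟫_ℝ := by
          rw [Finset.sum_comm]
          refine Finset.sum_congr rfl fun l _ => ?_
          rw [← Finset.mul_sum, hM, sum_inner]
          simp only [real_inner_smul_left]
      _ = _ := by
          refine Finset.sum_congr rfl fun l _ => ?_
          rw [hM', sum_inner, Finset.mul_sum]
          refine Finset.sum_congr rfl fun j _ => ?_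
          rw [real_inner_smul_left]
          ring
  have hle : ENNReal.ofReal (∑ i, c i * ⟪y i, T (x i)⟫_ℝ) ≤
      ∑ i, ∑ j, ENNReal.ofReal (s i) * ENNReal.ofReal (t j) * a i j := by
    have : ∑ i, ∑ j, ENNReal.ofReal (s i) * ENNReal.ofReal (t j) * a i j =
        ENNReal.ofReal (∑ i, ∑ j, s i * t j * |⟪v' j, v i⟫_ℝ * ⟪w' j, w i⟫_ℝ|) := by
      have h0 : ∀ i j, 0 ≤ s i * t j * |⟪v' j, v i⟫_ℝ * ⟪w' j, w i⟫_ℝ| := fun i j =>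
        mul_nonneg (mul_nonneg (hs0 i) (ht0 j)) (abs_nonneg _)
      rw [ENNReal.ofReal_sum_of_nonneg fun i _ => Finset.sum_nonneg fun j _ => h0 i j]
      refine Finset.sum_congr rfl fun i _ => ?_
      rw [ENNReal.ofReal_sum_of_nonneg fun j _ => h0 i j]
      refine Finset.sum_congr rfl fun j _ => ?_
      rw [ENNReal.ofReal_mul (mul_nonneg (hs0 i) (ht0 j)), ENNReal.ofReal_mul (hs0 i)]
    rw [this, key]
    refine ENNReal.ofReal_le_ofReal (Finset.sum_le_sum fun i _ => Finset.sum_le_sum fun j _ => ?_)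
    exact mul_le_mul_of_nonneg_left (le_abs_self _) (mul_nonneg (hs0 i) (ht0 j))
  refine hle.trans ?_
  -- The endpoints are separate because real conjugate exponents exclude `1` and `∞`. For `p = ∞`
  -- the roles of `s` and `t` are exchanged.
  rcases eq_or_ne p ∞ with rfl | hp'
  · obtain rfl : q = 1 := by simpa using hpq
    have h1 := sum_rpow_le_schattenNorm (T := M) ENNReal.one_ne_top ht
    simp only [ENNReal.toReal_one, ENNReal.rpow_one, div_one] at h1
    rw [Finset.sum_comm, mul_comm]
    refine le_trans ?_ ((sum_mul_le_of_substochastic_one_top hcol (fun j => ENNReal.ofReal (t j))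
      (ofReal_le_schattenNorm_top hs)).trans (mul_le_mul_left h1 _))
    simp only [mul_comm (ENNReal.ofReal (s _)), le_refl]
  rcases eq_or_ne q ∞ with rfl | hq'
  · obtain rfl : p = 1 := by simpa using hpq
    have h1 := sum_rpow_le_schattenNorm (T := T) ENNReal.one_ne_top hs
    simp only [ENNReal.toReal_one, ENNReal.rpow_one, div_one] at h1
    exact (sum_mul_le_of_substochastic_one_top hrow _ (ofReal_le_schattenNorm_top ht)).trans
      (mul_le_mul_left h1 _)
  have hpos : 0 < p.toReal := ENNReal.toReal_pos (zero_lt_one.trans_le hp).ne' hp'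
  have hqos : 0 < q.toReal := ENNReal.toReal_pos (zero_lt_one.trans_le hq).ne' hq'
  have hconj : p.toReal.HolderConjugate q.toReal := by
    have := ENNReal.holderConjugate_iff.2 hpq
    exact ENNReal.HolderConjugate.toReal_of_ne_top hp' hq'
  exact (sum_mul_le_of_substochastic hconj hrow hcol _ _).trans
    (mul_le_mul' (sum_rpow_le_schattenNorm hp' hs) (sum_rpow_le_schattenNorm hq' ht))

end TraceDuality

/-! ### Hankel operators, sign matrices and the bound for fixed signs -/

section Words

variable {A : Type*}

theorem WFA.eval_append {n : ℕ} (W : WFA A n) (x y : List A) :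
    W.eval (x ++ y) =
      W.init ⬝ᵥ ((x.map W.trans).prod.mulVec ((y.map W.trans).prod.mulVec W.final)) := by
  simp [WFA.eval, Matrix.mulVec_mulVec]

/-- A bounded operator represented by the Hankel matrix of a rational function has finite rank. -/
theorem IsRational.finiteDimensional_range {f : List A → ℝ} (hf : IsRational f)
    {T : WordL2 A →L[ℝ] WordL2 A} (hT : Represents (hankelMatrix f) T) :
    FiniteDimensional ℝ (LinearMap.range (T : WordL2 A →ₗ[ℝ] WordL2 A)) := by
  obtain ⟨n, -, W, rfl⟩ := hf
  -- Every column of the Hankel matrix lies in the range of `φ`. That range has finite dimension,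
  -- hence is closed under pointwise limits, so it contains every `T g`.
  let φ : (Fin n → ℝ) →ₗ[ℝ] (List A → ℝ) :=
    { toFun := fun c x => W.init ⬝ᵥ ((x.map W.trans).prod.mulVec c)
      map_add' := fun c d => by ext x; simp [Matrix.mulVec_add]
      map_smul' := fun k c => by ext x; simp [Matrix.mulVec_smul] }
  have hclosed : IsClosed (LinearMap.range φ : Set (List A → ℝ)) :=
    Submodule.closed_of_finiteDimensional _
  have hmem : ∀ g, (T g : List A → ℝ) ∈ LinearMap.range φ := fun g => by
    have hsum : HasSum (fun y x => hankelMatrix W.eval x y * g y) (T g : List A → ℝ) :=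
      Pi.hasSum.2 fun x => hT g x
    refine hclosed.mem_of_tendsto hsum (Filter.Eventually.of_forall fun s => ?_)
    refine Submodule.sum_mem _ fun y _ => ⟨g y • (y.map W.trans).prod.mulVec W.final, ?_⟩
    ext x
    simp only [map_smul, Pi.smul_apply, smul_eq_mul, hankelMatrix, Matrix.of_apply,
      WFA.eval_append, φ, LinearMap.coe_mk, AddHom.coe_mk]
    ring
  let ψ : LinearMap.range (T : WordL2 A →ₗ[ℝ] WordL2 A) →ₗ[ℝ] LinearMap.range φ :=
    { toFun := fun h => ⟨(h : WordL2 A), by obtain ⟨_, g, rfl⟩ := h; exact hmem g⟩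
      map_add' := fun _ _ => rfl
      map_smul' := fun _ _ => rfl }
  refine FiniteDimensional.of_injective ψ fun h h' hh => ?_
  have hval : (ψ h : List A → ℝ) = ψ h' := congrArg Subtype.val hh
  exact Subtype.ext (lp.ext hval)

theorem Represents.matrixSchattenNorm_eq {M : Matrix (List A) (List A) ℝ}
    {T : WordL2 A →L[ℝ] WordL2 A} (h : Represents M T) (p : ℝ≥0∞) :
    matrixSchattenNorm p M = schattenNorm p T := by
  refine le_antisymm (iInf₂_le T h) (le_iInf₂ fun T' h' => ?_)
  rw [h.unique h']

theorem exists_represents_of_matrixSchattenNorm_ne_top {p : ℝ≥0∞}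
    {M : Matrix (List A) (List A) ℝ} (h : matrixSchattenNorm p M ≠ ∞) : ∃ T, Represents M T := by
  by_contra! hM
  exact h (by simp [matrixSchattenNorm, hM])

variable [DecidableEq A]

/-- Matrix entries as inner products: this turns sample values of `f` into the trace pairing. -/
theorem Represents.inner_single {M : Matrix (List A) (List A) ℝ} {T : WordL2 A →L[ℝ] WordL2 A}
    (h : Represents M T) (u v : List A) :
    ⟪(lp.single 2 u 1 : WordL2 A), T (lp.single 2 v 1)⟫_ℝ = M u v := by
  have h1 := h (lp.single 2 v 1) u
  have h2 : HasSum (fun y => M u y * (lp.single 2 v 1 : WordL2 A) y) (M u v) := by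
    convert! hasSum_single (f := fun y => M u y * (lp.single 2 v 1 : WordL2 A) y) v
      fun y hy => by simp [hy] using 1
    simp
  rw [lp.inner_single_left, h1.unique h2]
  simp

/-- The finite rank operator with matrix `signMatrix u v σ`. -/
noncomputable def signOperator {m : ℕ} (u v : Fin m → List A) (σ : Fin m → ℤˣ) :
    WordL2 A →L[ℝ] WordL2 A :=
  ∑ i, ((σ i : ℤ) : ℝ) • (innerSL ℝ (lp.single 2 (v i) 1 : WordL2 A)).smulRight
    (lp.single 2 (u i) 1 : WordL2 A)

theorem signOperator_apply {m : ℕ} (u v : Fin m → List A) (σ : Fin m → ℤˣ) (z : WordL2 A) :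
    signOperator u v σ z = ∑ i, (((σ i : ℤ) : ℝ) * ⟪(lp.single 2 (v i) 1 : WordL2 A), z⟫_ℝ) •
      (lp.single 2 (u i) 1 : WordL2 A) := by
  simp [signOperator, smul_smul]

theorem represents_signOperator {m : ℕ} (u v : Fin m → List A) (σ : Fin m → ℤˣ) :
    Represents (signMatrix u v σ) (signOperator u v σ) := by
  intro g x
  have h : ∀ i, HasSum
      (fun y => ((σ i : ℤ) : ℝ) * ((Pi.single (u i) 1 : List A → ℝ) x *
        (Pi.single (v i) 1 : List A → ℝ) y) * g y)
      (((σ i : ℤ) : ℝ) * g (v i) * (Pi.single (u i) 1 : List A → ℝ) x) := fun i => by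
    convert! hasSum_single (f := fun y => ((σ i : ℤ) : ℝ) *
      ((Pi.single (u i) 1 : List A → ℝ) x * (Pi.single (v i) 1 : List A → ℝ) y) * g y) (v i)
      fun y hy => by simp [hy] using 1
    rw [Pi.single_eq_same]
    ring
  convert! hasSum_sum fun i (_ : i ∈ Finset.univ) => h i using 1
  · ext y
    simp [signMatrix, Matrix.sum_apply, Matrix.vecMulVec_apply, Finset.sum_mul]
  · rw [signOperator_apply, lp.coeFn_sum]
    simp [lp.inner_single_left]

instance finiteDimensional_range_signOperator {m : ℕ} (u v : Fin m → List A) (σ : Fin m → ℤˣ) :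
    FiniteDimensional ℝ
      (LinearMap.range (signOperator u v σ : WordL2 A →ₗ[ℝ] WordL2 A)) := by
  have : LinearMap.range (signOperator u v σ : WordL2 A →ₗ[ℝ] WordL2 A) ≤
      Submodule.span ℝ (Set.range fun i => (lp.single 2 (u i) 1 : WordL2 A)) := by
    rintro _ ⟨z, rfl⟩
    rw [ContinuousLinearMap.coe_coe, signOperator_apply]
    exact Submodule.sum_mem _ fun i _ =>
      Submodule.smul_mem _ _ (Submodule.subset_span ⟨i, rfl⟩)
  have := FiniteDimensional.span_of_finite ℝ
    (Set.finite_range fun i => (lp.single 2 (u i) 1 : WordL2 A))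
  exact Submodule.finiteDimensional_of_le ‹_ ≤ _›

theorem matrixSchattenNorm_signMatrix_ne_top {q : ℝ≥0∞} (hq : 1 ≤ q) {m : ℕ}
    (u v : Fin m → List A) (σ : Fin m → ℤˣ) : matrixSchattenNorm q (signMatrix u v σ) ≠ ∞ := by
  rw [(represents_signOperator u v σ).matrixSchattenNorm_eq]
  exact schattenNorm_ne_top _ hq

theorem signCorrelation_le {p q : ℝ≥0∞} (hp : 1 ≤ p) (hq : 1 ≤ q) (hpq : p⁻¹ + q⁻¹ = 1) {r : ℝ}
    (hr : 0 < r) {m : ℕ} {x u v : Fin m → List A} (hx : ∀ i, x i = u i ++ v i)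
    (σ : Fin m → ℤˣ) {f : List A → ℝ} (hf : f ∈ hankelSchattenBall A p r) :
    signCorrelation x σ f ≤ r / m * (matrixSchattenNorm q (signMatrix u v σ)).toReal := by
  obtain ⟨hrat, hnorm⟩ := hf
  obtain ⟨T, hT⟩ := exists_represents_of_matrixSchattenNorm_ne_top
    (ne_top_of_le_ne_top ENNReal.ofReal_ne_top hnorm)
  have := hrat.finiteDimensional_range hT
  rw [hT.matrixSchattenNorm_eq] at hnorm
  have h1 := sum_inner_le_schattenNorm_mul T (signOperator u v σ) hp hq hpq
    (signOperator_apply u v σ)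
  rw [← (represents_signOperator u v σ).matrixSchattenNorm_eq] at h1
  have h2 := h1.trans (mul_le_mul_left hnorm _)
  rw [← ENNReal.ofReal_toReal (matrixSchattenNorm_signMatrix_ne_top hq u v σ),
    ← ENNReal.ofReal_mul hr.le, ENNReal.ofReal_le_ofReal_iff (by positivity)] at h2
  simp only [hT.inner_single, hankelMatrix, Matrix.of_apply, ← hx] at h2
  calc signCorrelation x σ f ≤ 1 / (m : ℝ) *
        (r * (matrixSchattenNorm q (signMatrix u v σ)).toReal) :=
        mul_le_mul_of_nonneg_left h2 (by positivity)
    _ = _ := by ring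

end Words

end HankelRademacher

theorem mainTheorem3 {A : Type*} [Fintype A] [DecidableEq A] (p q : ℝ≥0∞) (hp : 1 ≤ p)
    (hq : 1 ≤ q) (hpq : p⁻¹ + q⁻¹ = 1) (r : ℝ) (hr : 0 < r) (m : ℕ) (hm : 1 ≤ m)
    (x u v : Fin m → List A) (hx : ∀ i, x i = u i ++ v i) :
    (∀ σ : Fin m → ℤˣ,
      BddAbove (Set.range fun f : hankelSchattenBall A p r => signCorrelation x σ f)) ∧
    (∀ σ : Fin m → ℤˣ, matrixSchattenNorm q (signMatrix u v σ) ≠ ∞) ∧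
    empiricalRademacher x (hankelSchattenBall A p r) ≤
      r / m * signExpectation
        (fun σ : Fin m → ℤˣ => (matrixSchattenNorm q (signMatrix u v σ)).toReal) := by
  have hle : ∀ (σ : Fin m → ℤˣ) (f : hankelSchattenBall A p r), signCorrelation x σ f ≤
      r / m * (matrixSchattenNorm q (signMatrix u v σ)).toReal := fun σ f =>
    signCorrelation_le hp hq hpq hr hx σ f.2
  refine ⟨fun σ => ⟨_, Set.forall_mem_range.2 (hle σ)⟩,
    matrixSchattenNorm_signMatrix_ne_top hq u v, ?_⟩
  rw [empiricalRademacher, signExpectation, signExpectation, mul_div_assoc', Finset.mul_sum]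
  gcongr with σ
  -- Nonnegativity of the bound covers the default value `0` of an empty supremum, so the class need
  -- not be shown nonempty.
  exact Real.iSup_le (hle σ) (by positivity)
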